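/- Let $S$ be a countable set and let $(Z_n)_{n\ge 0}$ be a time-homogeneous Markov chain on $S$ with respect to a filtration $(\mathcal A_n)_{n\ge 0}$; write $E_z$ for the expectation given $Z_0=z$. Let $g:S\to\mathbb R$ and $\alpha:S\to[0,1]$, and put $$X_n:=\Big(\prod_{i=0}^{n-1}\alpha(Z_i)\Big)g(Z_n)\quad(0\le n<\infty),\qquad X_\infty:=\limsup_{n\to\infty}X_n .$$ A stopping rule is an $(\mathcal A_n)$-stopping time with values in $\{0,1,2,\dots\}\cup\{\infty\}$. Assume that for every $z\in S$ the expectation $E_z[X_\tau]$ exists (possibly with an infinite value) for every stopping rule $\tau$, and that $$E_z\big[X_{\lim_n\sigma_n}\big]=\lim_{n\to\infty}E_z[X_{\sigma_n}]$$ for every non-decreasing sequence $(\sigma_n)_{n\ge0}$ of stopping rules. For $B\subseteq S$ let $\mathcal T[B]$ be the set of stopping rules $\tau$ with $Z_\tau\in B$ on $\{\tau<\infty\}$. For an integer $l\ge 0$ let $\tau_l(B):=\inf\{n\ge l: Z_n\in B\}$ (with $\inf\emptyset=\infty$), and for an integer $k\ge1$ let $$B^{*k}:=\{z\in B:\ g(z)\ge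 E_z[X_{\tau_l(B)}]\ \text{ for all } l=1,\dots,k\}.$$ Let $\kappa:\{1,2,\dots\}\to\{1,2,\dots\}$ be an arbitrary function, let $B^0\subseteq S$ be an arbitrary set, and define $B^k:=(B^{k-1})^{*\kappa(k)}$ for $k\ge1$ and $F:=\bigcap_{k\ge0}B^k$. Then $\tau_0(F)$ is optimal in $\mathcal T[B^0]$, that is, $\tau_0(F)\in\mathcal T[B^0]$ and $E_z[X_\sigma]\le E_z[X_{\tau_0(F)}]$ for all $\sigma\in\mathcal T[B^0]$ and all $z\in S$. Moreover, $$\tau_0(B^k)\le\tau_0(B^{k+1})\ \text{ for all } k\ge0,\qquad \lim_{k\to\infty}\tau_0(B^k)=\tau_0(F),$$ $$E_z[X_{\tau_0(B^k)}]\le E_z[X_{\tau_0(B^{k+1})}]\ \text{ for all } k\ge0 \text{ and all } z\in S .$$ -/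

import Mathlib

open MeasureTheory Filter Topology
open scoped ENNReal

noncomputable section

/-- `Z` is a time-homogeneous Markov chain on the countable state space `S`, with respect to the
filtration `𝓐`, with transition probabilities `p`; `P z` is the law of the experiment given
`Z 0 = z`, so that the expectation given `Z 0 = z` is the expectation under `P z`. -/
structure IsMarkovChainFamily {Ω S : Type*} {mΩ : MeasurableSpace Ω} [MeasurableSpace S]
    (𝓐 : Filtration ℕ mΩ) (P : S → Measure Ω) (p : S → PMF S) (Z : ℕ → Ω → S) : Prop where
  isProbabilityMeasure : ∀ z, IsProbabilityMeasure (P z)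
  adapted : Adapted 𝓐 Z
  start : ∀ z, ∀ᵐ ω ∂P z, Z 0 ω = z
  markov : ∀ (z : S) (n : ℕ) (A : Set Ω), MeasurableSet[𝓐 n] A → ∀ x y : S,
    P z (A ∩ {ω | Z n ω = x} ∩ {ω | Z (n + 1) ω = y}) = P z (A ∩ {ω | Z n ω = x}) * p x y

/-- The pay-off `X_n = (∏_{i < n} α (Z_i)) g (Z_n)` at a finite time `n`. -/
def payoff {Ω S : Type*} (α g : S → ℝ) (Z : ℕ → Ω → S) (n : ℕ) (ω : Ω) : ℝ :=
  (∏ i ∈ Finset.range n, α (Z i ω)) * g (Z n ω)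

open scoped Classical in
/-- The pay-off `X_τ` at a random time `τ` with values in `{0, 1, 2, …, ∞}`, where
`X_∞ = limsup_n X_n` is taken in the extended reals. -/
def payoffAt {Ω S : Type*} (α g : S → ℝ) (Z : ℕ → Ω → S) (τ : Ω → ℕ∞) (ω : Ω) : EReal :=
  if τ ω = ⊤ then limsup (fun n : ℕ => (payoff α g Z n ω : EReal)) atTop
  else (payoff α g Z (τ ω).toNat ω : EReal)

/-- The expectation `E[Y⁺] - E[Y⁻]` of an extended real random variable exists
(possibly with an infinite value) if `E[Y⁺]` and `E[Y⁻]` are not both infinite. -/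
def ExpectationExists {Ω : Type*} {mΩ : MeasurableSpace Ω} (μ : Measure Ω) (Y : Ω → EReal) :
    Prop :=
  AEMeasurable Y μ ∧
    (∫⁻ ω, (Y ω).toENNReal ∂μ ≠ ⊤ ∨ ∫⁻ ω, (-Y ω).toENNReal ∂μ ≠ ⊤)

/-- The extended real expectation `E[Y⁺] - E[Y⁻]`, meaningful when `ExpectationExists μ Y`. -/
def expectation {Ω : Type*} {mΩ : MeasurableSpace Ω} (μ : Measure Ω) (Y : Ω → EReal) : EReal :=
  ((∫⁻ ω, (Y ω).toENNReal ∂μ : ℝ≥0∞) : EReal) - ((∫⁻ ω, (-Y ω).toENNReal ∂μ : ℝ≥0∞) : EReal)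

/-- `stoppingRules 𝓐` is the set of all stopping rules with respect to `𝓐`
(the value `∞` is allowed). -/
def stoppingRules {Ω : Type*} {mΩ : MeasurableSpace Ω} (𝓐 : Filtration ℕ mΩ) : Set (Ω → ℕ∞) :=
  {τ | IsStoppingTime 𝓐 τ}

/-- The stopping rules that stop only in `B`, that is, with `Z_τ ∈ B` whenever `τ < ∞`. -/
def stoppingRulesIn {Ω S : Type*} {mΩ : MeasurableSpace Ω} (𝓐 : Filtration ℕ mΩ)
    (Z : ℕ → Ω → S) (B : Set S) : Set (Ω → ℕ∞) :=
  {τ | τ ∈ stoppingRules 𝓐 ∧ ∀ ω, τ ω ≠ ⊤ → Z (τ ω).toNat ω ∈ B}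

/-- `τ_l(B) = inf {n ≥ l : Z_n ∈ B}` (with `inf ∅ = ∞`), the first entrance time into `B`
at or after time `l`. -/
def entranceTime {Ω S : Type*} (Z : ℕ → Ω → S) (l : ℕ) (B : Set S) : Ω → ℕ∞ :=
  hittingAfter Z B l

/-- `B^{*k}`: the states `z ∈ B` with `g z ≥ E_z[X_{τ_l(B)}]` for `l = 1, …, k`. -/
def improveSet {Ω S : Type*} {mΩ : MeasurableSpace Ω} (P : S → Measure Ω) (α g : S → ℝ)
    (Z : ℕ → Ω → S) (B : Set S) (k : ℕ) : Set S :=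
  {z | z ∈ B ∧ ∀ l : ℕ, 1 ≤ l → l ≤ k →
    expectation (P z) (payoffAt α g Z (entranceTime Z l B)) ≤ (g z : EReal)}

/-- The sets `B^k` with `B^0 = B₀` and `B^k = (B^{k-1})^{*κ(k)}` for `k ≥ 1`. -/
def iterSet {Ω S : Type*} {mΩ : MeasurableSpace Ω} (P : S → Measure Ω) (α g : S → ℝ)
    (Z : ℕ → Ω → S) (κ : ℕ → ℕ) (B₀ : Set S) : ℕ → Set S
  | 0 => B₀
  | k + 1 => improveSet P α g Z (iterSet P α g Z κ B₀ k) (κ (k + 1))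

/-- `τ` is optimal in the class `𝓒`: it belongs to `𝓒` and maximizes `E_z[X_τ]` over `𝓒`
simultaneously for all initial states `z`. -/
def IsOptimalIn {Ω S : Type*} {mΩ : MeasurableSpace Ω} (P : S → Measure Ω) (α g : S → ℝ)
    (Z : ℕ → Ω → S) (𝓒 : Set (Ω → ℕ∞)) (τ : Ω → ℕ∞) : Prop :=
  τ ∈ 𝓒 ∧ ∀ σ ∈ 𝓒, ∀ z : S,
    expectation (P z) (payoffAt α g Z σ) ≤ expectation (P z) (payoffAt α g Z τ)

end

/-- Finite measures on `ℕ → S` with `S` countable agree if they agree on all initial cylinders. -/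
theorem measure_path_ext {S : Type*} [Countable S] [MeasurableSpace S]
    [DiscreteMeasurableSpace S] {μ ν : Measure (ℕ → S)} [IsFiniteMeasure ν]
    (h : ∀ (m : ℕ) (s : ℕ → S), μ {t | ∀ i ≤ m, t i = s i} = ν {t | ∀ i ≤ m, t i = s i}) :
    μ = ν := by
  have hfam : IsProjectiveMeasureFamily (fun I : Finset ℕ => ν.map I.restrict) := by
    intro I J hJI
    rw [Measure.map_map (by fun_prop) (by fun_prop)]
    rfl
  have hν : IsProjectiveLimit ν (fun I : Finset ℕ => ν.map I.restrict) := fun I => rfl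
  refine IsProjectiveLimit.unique (P := fun I : Finset ℕ => ν.map I.restrict) ?_ hν
  rw [isProjectiveLimit_nat_iff hfam]
  intro n
  refine Measure.ext_of_singleton fun a => ?_
  rcases isEmpty_or_nonempty S with hS | ⟨⟨x₀⟩⟩
  · exact hS.elim (a ⟨0, by simp⟩)
  · rw [Measure.map_apply (Preorder.measurable_frestrictLe n) (measurableSet_singleton a),
      Measure.map_apply (by fun_prop) (measurableSet_singleton a)]
    have key : ∀ t : ℕ → S, Preorder.frestrictLe n t = a ↔
        ∀ i ≤ n, t i = if hi : i ≤ n then a ⟨i, by simpa using hi⟩ else x₀ := by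
      intro t
      constructor
      · rintro rfl i hi
        simp [hi]
      · intro ht
        ext ⟨i, hi⟩
        have hi' : i ≤ n := by simpa using hi
        simpa [hi'] using ht i hi'
    have e : Preorder.frestrictLe (π := fun _ => S) n ⁻¹' {a} = {t : ℕ → S |
        ∀ i ≤ n, t i = if hi : i ≤ n then a ⟨i, by simpa using hi⟩ else x₀} := by
      ext t
      exact key t
    rw [e, h]
    congr 1
    exact e.symm

section Markov

variable {Ω S : Type*} {mΩ : MeasurableSpace Ω} [MeasurableSpace S]
  {𝓐 : Filtration ℕ mΩ} {P : S → Measure Ω} {p : S → PMF S} {Z : ℕ → Ω → S}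

theorem IsMarkovChainFamily.measurableSet_eq [DiscreteMeasurableSpace S]
    (hZ : IsMarkovChainFamily 𝓐 P p Z) {n m : ℕ}
    (hnm : n ≤ m) (x : S) : MeasurableSet[𝓐 m] {ω | Z n ω = x} :=
  𝓐.mono hnm _ (hZ.adapted n (measurableSet_singleton x))

theorem IsMarkovChainFamily.measurableSet_mem [DiscreteMeasurableSpace S]
    (hZ : IsMarkovChainFamily 𝓐 P p Z) {n m : ℕ}
    (hnm : n ≤ m) (B : Set S) : MeasurableSet[𝓐 m] {ω | Z n ω ∈ B} :=
  𝓐.mono hnm _ (hZ.adapted n (MeasurableSet.of_discrete (s := B)))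

theorem IsMarkovChainFamily.measurable (hZ : IsMarkovChainFamily 𝓐 P p Z) (n : ℕ) :
    Measurable (Z n) :=
  (hZ.adapted n).mono (𝓐.le n) le_rfl

theorem IsMarkovChainFamily.measurable_shift (hZ : IsMarkovChainFamily 𝓐 P p Z) (n : ℕ) :
    Measurable (fun ω m => Z (n + m) ω) :=
  measurable_pi_lambda _ fun m => hZ.measurable (n + m)

theorem IsMarkovChainFamily.measure_path [DiscreteMeasurableSpace S]
    (hZ : IsMarkovChainFamily 𝓐 P p Z) (z : S) {n : ℕ}
    {A : Set Ω} (hA : MeasurableSet[𝓐 n] A) (s : ℕ → S) (m : ℕ) :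
    P z (A ∩ {ω | ∀ i ≤ m, Z (n + i) ω = s i}) =
      P z (A ∩ {ω | Z n ω = s 0}) * ∏ i ∈ Finset.range m, (p (s i)) (s (i + 1)) := by
  induction m with
  | zero => simp
  | succ m ih =>
    have hA' : MeasurableSet[𝓐 (n + m)] (A ∩ {ω | ∀ i ≤ m, Z (n + i) ω = s i}) := by
      refine MeasurableSet.inter (𝓐.mono (by omega) _ hA) ?_
      have : {ω | ∀ i ≤ m, Z (n + i) ω = s i} = ⋂ i, ⋂ (_ : i ≤ m), {ω | Z (n + i) ω = s i} := by
        ext ω; simp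
      rw [this]
      exact MeasurableSet.iInter fun i => MeasurableSet.iInter fun hi =>
        hZ.measurableSet_eq (by omega) _
    have h := hZ.markov z (n + m) _ hA' (s m) (s (m + 1))
    have e₁ : A ∩ {ω | ∀ i ≤ m, Z (n + i) ω = s i} ∩ {ω | Z (n + m) ω = s m} =
        A ∩ {ω | ∀ i ≤ m, Z (n + i) ω = s i} :=
      Set.inter_eq_left.2 fun ω hω => hω.2 m le_rfl
    have e₂ : A ∩ {ω | ∀ i ≤ m + 1, Z (n + i) ω = s i} =
        A ∩ {ω | ∀ i ≤ m, Z (n + i) ω = s i} ∩ {ω | Z (n + m + 1) ω = s (m + 1)} := by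
      ext ω
      simp only [Set.mem_inter_iff, Set.mem_ofPred_eq, and_assoc, add_assoc]
      refine and_congr_right fun _ => ⟨fun h => ⟨fun i hi => h i (by omega), h _ le_rfl⟩,
        fun h i hi => ?_⟩
      rcases Nat.le_succ_iff.1 hi with hi | rfl
      · exact h.1 i hi
      · exact h.2
    rw [e₁] at h
    rw [e₂, h, ih, Finset.prod_range_succ, mul_assoc]

/-- The Markov property for the whole future of the chain. -/
theorem IsMarkovChainFamily.map_restrict [Countable S] [DiscreteMeasurableSpace S]
    (hZ : IsMarkovChainFamily 𝓐 P p Z) (z : S) {n : ℕ}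
    {A : Set Ω} (hA : MeasurableSet[𝓐 n] A) {x : S} (hx : A ⊆ {ω | Z n ω = x}) :
    ((P z).restrict A).map (fun ω m => Z (n + m) ω) =
      P z A • (P x).map (fun ω m => Z m ω) := by
  have := hZ.isProbabilityMeasure
  have hfin : IsFiniteMeasure (P z A • (P x).map (fun ω m => Z m ω)) :=
    Measure.smul_finite _ (measure_ne_top _ _)
  refine measure_path_ext fun m s => ?_
  have hm : MeasurableSet {t : ℕ → S | ∀ i ≤ m, t i = s i} := by
    have : {t : ℕ → S | ∀ i ≤ m, t i = s i} =
        ⋂ i, ⋂ (_ : i ≤ m), (fun t : ℕ → S => t i) ⁻¹' {s i} := by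
      ext t; simp
    rw [this]
    exact MeasurableSet.iInter fun i => MeasurableSet.iInter fun _ =>
      measurable_pi_apply i (measurableSet_singleton _)
  have h₀ : Measurable (fun ω m => Z m ω) := by simpa using hZ.measurable_shift 0
  rw [Measure.smul_apply, Measure.map_apply (hZ.measurable_shift n) hm,
    Measure.restrict_apply (hZ.measurable_shift n hm), Measure.map_apply h₀ hm,
    Set.inter_comm]
  have h₁ := hZ.measure_path z hA s m
  have h₂ := hZ.measure_path x (n := 0) (A := Set.univ) MeasurableSet.univ s m
  simp only [Set.univ_inter, zero_add] at h₂
  simp only [Set.preimage_ofPred_eq, smul_eq_mul]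
  rw [h₁, h₂, ← mul_assoc]
  congr 1
  by_cases hxs : s 0 = x
  · have e : A ∩ {ω | Z n ω = s 0} = A := Set.inter_eq_left.2 (hxs ▸ hx)
    have e' : P x {ω | Z 0 ω = s 0} = 1 := by
      rw [← measure_univ (μ := P x)]
      refine measure_congr ?_
      filter_upwards [hZ.start x] with ω hω
      exact propext ⟨fun _ => trivial, fun _ => hω.trans hxs.symm⟩
    rw [e, e', mul_one]
  · have e : A ∩ {ω | Z n ω = s 0} = ∅ := by
      ext ω
      simp only [Set.mem_inter_iff, Set.mem_ofPred_eq, Set.mem_empty_iff_false, iff_false, not_and]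
      intro hω h
      exact hxs (h.symm.trans (hx hω))
    have e' : P x {ω | Z 0 ω = s 0} = 0 := by
      have := hZ.start x
      refine measure_mono_null (fun ω hω => ?_) this
      simp only [Set.mem_ofPred_eq] at hω
      simp [hω, hxs]
    rw [e, e', measure_empty, mul_zero]

end Markov

section Expectation

variable {Ω : Type*} {mΩ : MeasurableSpace Ω}

theorem EReal.coe_sub_coe_le_iff {a b c d : ℝ≥0∞} (hab : a ≠ ⊤ ∨ b ≠ ⊤) (hcd : c ≠ ⊤ ∨ d ≠ ⊤) :
    (a : EReal) - b ≤ (c : EReal) - d ↔ a + d ≤ c + b := by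
  by_cases hb : b = ⊤
  · subst hb
    lift a to NNReal using by simpa using hab
    simp
  by_cases hc : c = ⊤
  · subst hc
    lift d to NNReal using by simpa using hcd
    simp
  lift b to NNReal using hb
  lift c to NNReal using hc
  by_cases ha : a = ⊤
  · subst ha
    simp only [EReal.coe_ennreal_top, top_add, top_le_iff, ENNReal.add_eq_top,
      ENNReal.coe_ne_top, or_self, iff_false, not_le]
    induction d with
    | top => simp
    | coe d => exact_mod_cast EReal.coe_lt_top _
  by_cases hd : d = ⊤
  · subst hd
    lift a to NNReal using ha
    simp only [EReal.coe_ennreal_top, add_top, top_le_iff, ENNReal.add_eq_top,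
      ENNReal.coe_ne_top, or_self, iff_false, not_le]
    exact_mod_cast EReal.bot_lt_coe _
  lift a to NNReal using ha
  lift d to NNReal using hd
  simp only [EReal.coe_nnreal_eq_coe_real]
  norm_cast
  rw [← NNReal.coe_le_coe, NNReal.coe_add, NNReal.coe_add]
  constructor <;> intro h <;> linarith

theorem expectation_le_expectation_iff {μ : Measure Ω} {Y Y' : Ω → EReal}
    (hY : ExpectationExists μ Y) (hY' : ExpectationExists μ Y') :
    expectation μ Y ≤ expectation μ Y' ↔
      ∫⁻ ω, (Y ω).toENNReal ∂μ + ∫⁻ ω, (-Y' ω).toENNReal ∂μ ≤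
        ∫⁻ ω, (Y' ω).toENNReal ∂μ + ∫⁻ ω, (-Y ω).toENNReal ∂μ :=
  EReal.coe_sub_coe_le_iff hY.2 hY'.2

end Expectation

section Payoff

variable {Ω S : Type*} {α g : S → ℝ} {Z : ℕ → Ω → S}

theorem payoffAt_congr {τ τ' : Ω → ℕ∞} {ω : Ω} (h : τ ω = τ' ω) :
    payoffAt α g Z τ ω = payoffAt α g Z τ' ω := by
  simp only [payoffAt, h]

theorem payoff_add (n m : ℕ) (ω : Ω) :
    payoff α g Z (n + m) ω = (∏ i ∈ Finset.range n, α (Z i ω)) *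
      payoff α g (fun i (s : ℕ → S) => s i) m (fun i => Z (n + i) ω) := by
  simp only [payoff, Finset.prod_range_add, mul_assoc]

/-- The pay-off of a continuation after time `n`, in terms of the shifted path. -/
theorem payoffAt_eq_mul (hα : ∀ z, 0 ≤ α z) {τ : Ω → ℕ∞} {u : (ℕ → S) → ℕ∞} {n : ℕ} {ω : Ω}
    (h : τ ω = n + u (fun i => Z (n + i) ω)) :
    payoffAt α g Z τ ω = ((∏ i ∈ Finset.range n, α (Z i ω) : ℝ) : EReal) *
      payoffAt α g (fun i (s : ℕ → S) => s i) u (fun i => Z (n + i) ω) := by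
  have hc : 0 ≤ ∏ i ∈ Finset.range n, α (Z i ω) := Finset.prod_nonneg fun i _ => hα _
  by_cases hu : u (fun i => Z (n + i) ω) = ⊤
  · rw [hu, add_top] at h
    simp only [payoffAt, h, hu, if_true]
    rw [← EReal.limsup_const_mul_of_nonneg_of_ne_top (EReal.coe_nonneg.2 hc)
      (EReal.coe_ne_top _), ← limsup_nat_add _ n]
    refine congrArg (fun f => limsup f atTop) (funext fun m => ?_)
    rw [add_comm m n, payoff_add, EReal.coe_mul]
  · lift u (fun i => Z (n + i) ω) to ℕ using hu with k hk
    have h' : τ ω = ((n + k : ℕ) : ℕ∞) := by simpa using h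
    simp only [payoffAt, h', ← hk, ENat.natCast_ne_top, if_false, ENat.toNat_natCast]
    rw [payoff_add, EReal.coe_mul]

theorem measurable_payoff_path [MeasurableSpace S] [DiscreteMeasurableSpace S] (n : ℕ) :
    Measurable (payoff α g (fun i (s : ℕ → S) => s i) n) := by
  have hα : Measurable α := .of_discrete
  have hg : Measurable g := .of_discrete
  unfold payoff
  fun_prop

theorem measurable_payoffAt_path [MeasurableSpace S] [DiscreteMeasurableSpace S] {u : (ℕ → S) → ℕ∞}
    (hu : Measurable u) : Measurable (payoffAt α g (fun i (s : ℕ → S) => s i) u) := by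
  unfold payoffAt
  refine Measurable.ite (hu (measurableSet_singleton ⊤)) ?_ ?_
  · exact Measurable.limsup fun n => (measurable_payoff_path n).coe_real_ereal
  · have h : Measurable (fun q : ℕ × (ℕ → S) =>
        payoff α g (fun i (s : ℕ → S) => s i) q.1 q.2) :=
      measurable_from_prod_countable_right fun n => measurable_payoff_path n
    exact (h.comp ((Measurable.of_discrete (f := ENat.toNat)).comp hu |>.prodMk
      measurable_id)).coe_real_ereal

theorem EReal.toENNReal_coe_mul {c : ℝ} (hc : 0 ≤ c) (y : EReal) :
    ((c : EReal) * y).toENNReal = ENNReal.ofReal c * y.toENNReal := by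
  rw [EReal.toENNReal_mul (EReal.coe_nonneg.2 hc)]
  simp

end Payoff

section Comparison

variable {Ω S : Type*} {mΩ : MeasurableSpace Ω} [Countable S] [MeasurableSpace S]
  [DiscreteMeasurableSpace S] {𝓐 : Filtration ℕ mΩ} {P : S → Measure Ω} {p : S → PMF S}
  {Z : ℕ → Ω → S} {α g : S → ℝ}

/-- Two stopping rules that differ only on an event `D` of the past at time `n`, where they continue
with `u (Z n)` and `u' (Z n)` applied to the shifted path, compare like their continuations. -/
theorem IsMarkovChainFamily.expectation_le_of_continuation (hZ : IsMarkovChainFamily 𝓐 P p Z)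
    (hα : ∀ z, 0 ≤ α z)
    (hexists : ∀ τ ∈ stoppingRules 𝓐, ∀ z : S, ExpectationExists (P z) (payoffAt α g Z τ))
    {n : ℕ} {D : Set Ω} (hD : MeasurableSet[𝓐 n] D) {τ τ' : Ω → ℕ∞}
    (hτ : τ ∈ stoppingRules 𝓐) (hτ' : τ' ∈ stoppingRules 𝓐) {u u' : S → (ℕ → S) → ℕ∞}
    (hu : ∀ x, Measurable (u x)) (hu' : ∀ x, Measurable (u' x))
    (hus : ∀ x, (fun ω => u x (fun i => Z i ω)) ∈ stoppingRules 𝓐)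
    (hus' : ∀ x, (fun ω => u' x (fun i => Z i ω)) ∈ stoppingRules 𝓐)
    (hτD : ∀ ω ∈ D, τ ω = n + u (Z n ω) (fun i => Z (n + i) ω))
    (hτD' : ∀ ω ∈ D, τ' ω = n + u' (Z n ω) (fun i => Z (n + i) ω))
    (hDc : ∀ ω ∉ D, τ ω = τ' ω)
    (hle : ∀ ω ∈ D, expectation (P (Z n ω)) (payoffAt α g Z fun ω' => u (Z n ω) fun i => Z i ω') ≤
      expectation (P (Z n ω)) (payoffAt α g Z fun ω' => u' (Z n ω) fun i => Z i ω')) (z : S) :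
    expectation (P z) (payoffAt α g Z τ) ≤ expectation (P z) (payoffAt α g Z τ') := by
  rw [expectation_le_expectation_iff (hexists τ hτ z) (hexists τ' hτ' z)]
  set Y := payoffAt α g Z τ with hY
  set Y' := payoffAt α g Z τ' with hY'
  have hDm : MeasurableSet D := 𝓐.le n _ hD
  let H : Ω → (Fin (n + 1) → S) := fun ω i => Z i ω
  have hH : Measurable[𝓐 n] H := by
    refine @measurable_pi_lambda _ _ _ (𝓐 n) _ _ fun i => ?_
    exact (hZ.adapted i).mono (𝓐.mono (Nat.lt_succ_iff.1 i.2)) le_rfl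
  have hcell : ∀ h, MeasurableSet[𝓐 n] (D ∩ H ⁻¹' {h}) := fun h =>
    hD.inter (hH (measurableSet_singleton h))
  have split : ∀ f : Ω → ℝ≥0∞, ∫⁻ ω, f ω ∂(P z) =
      ∑' h, ∫⁻ ω in D ∩ H ⁻¹' {h}, f ω ∂(P z) + ∫⁻ ω in Dᶜ, f ω ∂(P z) := by
    intro f
    have hU : ⋃ h, D ∩ H ⁻¹' {h} = D := by
      ext ω
      simp
    rw [← lintegral_add_compl f hDm, ← lintegral_iUnion (fun h => 𝓐.le n _ (hcell h)), hU]
    · intro h h' hne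
      refine Set.disjoint_left.2 fun ω hω hω' => hne ?_
      exact hω.2.symm.trans hω'.2
  rw [split, split (fun ω => (-Y' ω).toENNReal), split (fun ω => (Y' ω).toENNReal),
    split (fun ω => (-Y ω).toENNReal)]
  have hc : ∀ ω ∈ Dᶜ, Y ω = Y' ω := fun ω hω => payoffAt_congr (hDc ω hω)
  have e₁ : ∫⁻ ω in Dᶜ, (Y ω).toENNReal ∂(P z) = ∫⁻ ω in Dᶜ, (Y' ω).toENNReal ∂(P z) :=
    setLIntegral_congr_fun hDm.compl fun ω hω => by simp only [hc ω hω]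
  have e₂ : ∫⁻ ω in Dᶜ, (-Y ω).toENNReal ∂(P z) = ∫⁻ ω in Dᶜ, (-Y' ω).toENNReal ∂(P z) :=
    setLIntegral_congr_fun hDm.compl fun ω hω => by simp only [hc ω hω]
  rw [e₁, e₂, add_add_add_comm, 
    add_add_add_comm (∑' h, ∫⁻ ω in D ∩ H ⁻¹' {h}, (Y' ω).toENNReal ∂(P z)),
    ← ENNReal.tsum_add, ← ENNReal.tsum_add]
  refine add_le_add (ENNReal.tsum_le_tsum fun h => ?_) le_rfl
  rcases (D ∩ H ⁻¹' {h}).eq_empty_or_nonempty with hem | ⟨ω₀, hω₀⟩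
  · simp [hem]
  set A := D ∩ H ⁻¹' {h} with hA
  have hZA : ∀ ω ∈ A, ∀ i ≤ n, Z i ω = Z i ω₀ := by
    intro ω hω i hi
    have : H ω = H ω₀ := hω.2.trans hω₀.2.symm
    exact congrFun this ⟨i, Nat.lt_succ_iff.2 hi⟩
  set x := Z n ω₀ with hx
  set c : ℝ := ∏ i ∈ Finset.range n, α (Z i ω₀) with hcdef
  have hc0 : 0 ≤ c := Finset.prod_nonneg fun i _ => hα _
  have hprod : ∀ ω ∈ A, ∏ i ∈ Finset.range n, α (Z i ω) = c := fun ω hω =>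
    Finset.prod_congr rfl fun i hi => by rw [hZA ω hω i (Finset.mem_range.1 hi).le]
  have hAm : MeasurableSet A := 𝓐.le n _ (hcell h)
  have hmap := hZ.map_restrict z (hcell h) (x := x) fun ω hω => hZA ω hω n le_rfl
  have h₀ : Measurable (fun ω m => Z m ω) := by simpa using hZ.measurable_shift 0
  have transfer : ∀ f : (ℕ → S) → ℝ≥0∞, Measurable f →
      ∫⁻ ω in A, ENNReal.ofReal c * f (fun i => Z (n + i) ω) ∂(P z) =
        ENNReal.ofReal c * P z A * ∫⁻ ω, f (fun i => Z i ω) ∂(P x) := by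
    intro f hf
    rw [lintegral_const_mul (ENNReal.ofReal c) (f := fun ω => f fun i => Z (n + i) ω)
      (hf.comp (hZ.measurable_shift n)),
      ← lintegral_map hf (hZ.measurable_shift n), hmap, lintegral_smul_measure,
      lintegral_map hf h₀, smul_eq_mul, mul_assoc]
  have key : ∀ (ρ : Ω → ℕ∞) (v : (ℕ → S) → ℕ∞), Measurable v →
      (∀ ω ∈ A, ρ ω = n + v (fun i => Z (n + i) ω)) →
      ∫⁻ ω in A, (payoffAt α g Z ρ ω).toENNReal ∂(P z) = ENNReal.ofReal c * P z A *
        ∫⁻ ω, (payoffAt α g Z (fun ω' => v fun i => Z i ω') ω).toENNReal ∂(P x) ∧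
      ∫⁻ ω in A, (-payoffAt α g Z ρ ω).toENNReal ∂(P z) = ENNReal.ofReal c * P z A *
        ∫⁻ ω, (-payoffAt α g Z (fun ω' => v fun i => Z i ω') ω).toENNReal ∂(P x) := by
    intro ρ v hv hρ
    have hV := measurable_payoffAt_path (α := α) (g := g) hv
    constructor
    · refine (setLIntegral_congr_fun hAm fun ω hω => ?_).trans
        (transfer _ hV.ereal_toENNReal)
      simp only [payoffAt_eq_mul hα (hρ ω hω), hprod ω hω, EReal.toENNReal_coe_mul hc0]
    · refine (setLIntegral_congr_fun hAm fun ω hω => ?_).trans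
        (transfer _ hV.neg.ereal_toENNReal)
      simp only [payoffAt_eq_mul hα (hρ ω hω), hprod ω hω, ← mul_neg,
        EReal.toENNReal_coe_mul hc0, Pi.neg_apply]
  have hxA : ∀ ω ∈ A, Z n ω = x := fun ω hω => hZA ω hω n le_rfl
  obtain ⟨k₁, k₂⟩ := key τ (u x) (hu x) fun ω hω => hxA ω hω ▸ hτD ω hω.1
  obtain ⟨k₃, k₄⟩ := key τ' (u' x) (hu' x) fun ω hω => hxA ω hω ▸ hτD' ω hω.1
  rw [hY, hY', k₁, k₂, k₃, k₄, ← mul_add, ← mul_add]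
  refine mul_le_mul_right ?_ _
  rw [← expectation_le_expectation_iff (hexists _ (hus x) x) (hexists _ (hus' x) x)]
  exact hle ω₀ hω₀.1

end Comparison

section EntranceTime

variable {Ω S : Type*} {Z : ℕ → Ω → S} {B : Set S} {σ : Ω → ℕ∞} {ω : Ω}

theorem ENat.eq_of_forall_le_natCast_iff {a b : ℕ∞} (h : ∀ n : ℕ, a ≤ n ↔ b ≤ n) : a = b := by
  refine le_antisymm ?_ ?_
  · induction b with
    | top => exact le_top
    | coe b => exact (h b).2 le_rfl
  · induction a with
    | top => exact le_top
    | coe a => exact (h a).1 le_rfl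

theorem measurable_of_measurableSet_le_natCast {X : Type*} [MeasurableSpace X] {e : X → ℕ∞}
    (h : ∀ n : ℕ, MeasurableSet {x | e x ≤ n}) : Measurable e := by
  refine measurable_to_countable' fun a => ?_
  induction a with
  | top =>
    have : e ⁻¹' {⊤} = (⋃ n : ℕ, {x | e x ≤ n})ᶜ := by
      ext x
      simp only [Set.mem_preimage, Set.mem_singleton_iff, Set.mem_compl_iff, Set.mem_iUnion,
        Set.mem_ofPred_eq, not_exists, not_le]
      refine ⟨fun hx n => hx ▸ ENat.natCast_lt_top n, fun hx => ?_⟩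
      exact ENat.eq_top_iff_forall_gt.2 hx
    rw [this]
    exact (MeasurableSet.iUnion h).compl
  | coe n =>
    have : e ⁻¹' {(n : ℕ∞)} = {x | e x ≤ n} \ ⋃ m : ℕ, ⋃ (_ : m < n), {x | e x ≤ m} := by
      ext x
      simp only [Set.mem_preimage, Set.mem_singleton_iff, Set.mem_sdiff, Set.mem_iUnion,
        Set.mem_ofPred_eq, not_exists, not_le]
      refine ⟨fun hx => hx ▸ ⟨le_rfl, fun m hm => hx ▸ Nat.cast_lt.2 hm⟩, fun ⟨h₁, h₂⟩ => ?_⟩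
      lift e x to ℕ using ne_top_of_le_ne_top (ENat.natCast_ne_top n) h₁ with k
      rcases lt_or_eq_of_le h₁ with hlt | heq
      · exact absurd (h₂ k (by exact_mod_cast hlt)) (lt_irrefl _)
      · exact heq
    rw [this]
    exact (h n).diff (MeasurableSet.iUnion fun m => MeasurableSet.iUnion fun _ => h m)

theorem entranceTime_le_iff {l n : ℕ} :
    entranceTime Z l B ω ≤ n ↔ ∃ m, m ≤ n ∧ l ≤ m ∧ Z m ω ∈ B := by
  have := hittingAfter_le_iff (u := Z) (s := B) (n := l) (ω := ω) (i := n)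
  refine this.trans ⟨?_, ?_⟩
  · rintro ⟨m, hm, hB⟩
    exact ⟨m, hm.2, hm.1, hB⟩
  · rintro ⟨m, hm, hl, hB⟩
    exact ⟨m, ⟨hl, hm⟩, hB⟩

theorem natCast_le_entranceTime (l : ℕ) : (l : ℕ∞) ≤ entranceTime Z l B ω := by
  exact le_hittingAfter (u := Z) (s := B) (n := l) ω

open scoped Classical in
/-- The first entrance time into `B` at or after the random time `σ`. -/
noncomputable def entranceAfter (Z : ℕ → Ω → S) (σ : Ω → ℕ∞) (B : Set S) : Ω → ℕ∞ :=
  fun ω => if σ ω = ⊤ then ⊤ else entranceTime Z (σ ω).toNat B ω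

theorem entranceAfter_natCast (l : ℕ) :
    entranceAfter Z (fun _ => (l : ℕ∞)) B = entranceTime Z l B := by
  ext ω
  simp [entranceAfter]

theorem entranceAfter_le_iff {n : ℕ} :
    entranceAfter Z σ B ω ≤ n ↔ ∃ m : ℕ, m ≤ n ∧ σ ω ≤ m ∧ Z m ω ∈ B := by
  unfold entranceAfter
  split_ifs with h
  · simp [h]
  · rw [entranceTime_le_iff]
    lift σ ω to ℕ using h with k
    simp

theorem le_entranceAfter (ω : Ω) : σ ω ≤ entranceAfter Z σ B ω := by
  unfold entranceAfter
  split_ifs with h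
  · exact le_top
  · exact (ENat.natCast_toNat h).symm.le.trans (natCast_le_entranceTime _)

theorem entranceAfter_mem {n : ℕ} (h : entranceAfter Z σ B ω = n) : Z n ω ∈ B := by
  obtain ⟨m, hmn, hσ, hm⟩ := entranceAfter_le_iff.1 h.le
  have : n ≤ m := by
    exact_mod_cast h ▸ (entranceAfter_le_iff (Z := Z) (σ := σ) (B := B)).2 ⟨m, le_rfl, hσ, hm⟩
  rwa [le_antisymm this hmn]

theorem entranceTime_mem {l n : ℕ} (h : entranceTime Z l B ω = n) : Z n ω ∈ B :=
  entranceAfter_mem (σ := fun _ => (l : ℕ∞)) (by rwa [entranceAfter_natCast])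

theorem entranceAfter_anti {B' : Set S} (h : B' ⊆ B) (ω : Ω) :
    entranceAfter Z σ B ω ≤ entranceAfter Z σ B' ω := by
  induction hn : entranceAfter Z σ B' ω with
  | top => exact le_top
  | coe n =>
    obtain ⟨m, hmn, hσ, hm⟩ := entranceAfter_le_iff.1 hn.le
    exact entranceAfter_le_iff.2 ⟨m, hmn, hσ, h hm⟩

theorem entranceAfter_entranceAfter {B' : Set S} (h : B' ⊆ B) :
    entranceAfter Z (entranceAfter Z σ B) B' = entranceAfter Z σ B' := by
  ext ω : 1
  refine ENat.eq_of_forall_le_natCast_iff fun n => ?_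
  rw [entranceAfter_le_iff, entranceAfter_le_iff]
  refine exists_congr fun m => and_congr_right fun _ => ⟨fun ⟨h₁, h₂⟩ => ⟨?_, h₂⟩,
    fun ⟨h₁, h₂⟩ => ⟨entranceAfter_le_iff.2 ⟨m, le_rfl, h₁, h h₂⟩, h₂⟩⟩
  exact (le_entranceAfter ω).trans h₁

theorem entranceAfter_eq_self (h : ∀ n : ℕ, σ ω = n → Z n ω ∈ B) :
    entranceAfter Z σ B ω = σ ω := by
  refine le_antisymm ?_ (le_entranceAfter ω)
  induction hn : σ ω with
  | top => exact le_top
  | coe n => exact entranceAfter_le_iff.2 ⟨n, le_rfl, hn.le, h n hn⟩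

theorem entranceTime_add (n l : ℕ) (B : Set S) (ω : Ω) :
    entranceTime Z (n + l) B ω =
      n + entranceTime (fun i (s : ℕ → S) => s i) l B (fun i => Z (n + i) ω) := by
  refine ENat.eq_of_forall_le_natCast_iff fun k => ?_
  rw [entranceTime_le_iff]
  rcases le_or_gt n k with hnk | hnk
  · obtain ⟨j, rfl⟩ := Nat.exists_eq_add_of_le hnk
    rw [Nat.cast_add, ENat.add_le_add_iff_left (ENat.natCast_ne_top n), entranceTime_le_iff]
    constructor
    · rintro ⟨m, hm, hl, hB⟩
      refine ⟨m - n, by omega, by omega, ?_⟩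
      simpa only [show n + (m - n) = m by omega] using hB
    · rintro ⟨m, hm, hl, hB⟩
      exact ⟨n + m, by omega, by omega, hB⟩
  · refine iff_of_false ?_ ?_
    · rintro ⟨m, hm, hl, -⟩
      omega
    · intro h
      have : (n : ℕ∞) ≤ k := le_self_add.trans h
      exact absurd (by exact_mod_cast this) hnk.not_ge

theorem entranceTime_succ {n : ℕ} (h : Z n ω ∉ B) :
    entranceTime Z (n + 1) B ω = entranceTime Z n B ω := by
  refine ENat.eq_of_forall_le_natCast_iff fun k => ?_
  rw [entranceTime_le_iff, entranceTime_le_iff]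
  refine exists_congr fun m => and_congr_right fun _ => ⟨fun ⟨h₁, h₂⟩ => ⟨by omega, h₂⟩,
    fun ⟨h₁, h₂⟩ => ⟨?_, h₂⟩⟩
  rcases h₁.lt_or_eq with h₁ | rfl
  · exact h₁
  · exact absurd h₂ h

theorem measurable_entranceTime_path [MeasurableSpace S] [DiscreteMeasurableSpace S] (l : ℕ)
    (B : Set S) : Measurable (entranceTime (fun i (s : ℕ → S) => s i) l B) := by
  refine measurable_of_measurableSet_le_natCast fun n => ?_
  simp only [entranceTime_le_iff]
  have : {s : ℕ → S | ∃ m, m ≤ n ∧ l ≤ m ∧ s m ∈ B} =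
      ⋃ m, ⋃ (_ : m ≤ n ∧ l ≤ m), (fun s : ℕ → S => s m) ⁻¹' B := by
    ext s; simp [and_assoc]
  rw [this]
  exact MeasurableSet.iUnion fun m => MeasurableSet.iUnion fun _ =>
    measurable_pi_apply m .of_discrete

/-- For a decreasing sequence of sets, the entrance times increase to the entrance time of the
intersection. -/
theorem iSup_entranceAfter {B : ℕ → Set S} (hB : Antitone B) (σ : Ω → ℕ∞) (ω : Ω) :
    ⨆ k, entranceAfter Z σ (B k) ω = entranceAfter Z σ (⋂ k, B k) ω := by
  refine le_antisymm (iSup_le fun k => entranceAfter_anti (Set.iInter_subset _ k) ω) ?_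
  induction hn : ⨆ k, entranceAfter Z σ (B k) ω with
  | top => exact le_top
  | coe n =>
    rw [entranceAfter_le_iff]
    by_contra! hcon
    have hk : ∀ m : ℕ, ∃ k, m ≤ n → σ ω ≤ m → Z m ω ∉ B k := by
      intro m
      by_contra! hm
      have h₀ := hm 0
      exact hcon m h₀.1 h₀.2.1 (Set.mem_iInter.2 fun k => (hm k).2.2)
    choose k hk using hk
    let K := (Finset.range (n + 1)).sup k
    have hK : entranceAfter Z σ (B K) ω ≤ n :=
      hn ▸ le_iSup (fun k => entranceAfter Z σ (B k) ω) K
    obtain ⟨m, hmn, hσ, hm⟩ := entranceAfter_le_iff.1 hK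
    exact hk m hmn hσ (hB (Finset.le_sup (Finset.mem_range.2 (Nat.lt_succ_of_le hmn))) hm)

end EntranceTime

section StoppingRules

variable {Ω S : Type*} {mΩ : MeasurableSpace Ω} {𝓐 : Filtration ℕ mΩ}
  {Z : ℕ → Ω → S}

theorem mem_stoppingRulesIn_iff {B : Set S} {σ : Ω → ℕ∞} :
    σ ∈ stoppingRulesIn 𝓐 Z B ↔
      σ ∈ stoppingRules 𝓐 ∧ ∀ ω, ∀ n : ℕ, σ ω = n → Z n ω ∈ B := by
  refine and_congr_right fun _ => forall_congr' fun ω => ⟨fun h n hn => ?_, fun h hne => ?_⟩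
  · simpa [hn] using h (by simp [hn])
  · exact h _ (ENat.natCast_toNat hne).symm

theorem const_mem_stoppingRules (𝓐 : Filtration ℕ mΩ) (n : ℕ) :
    (fun _ => (n : ℕ∞)) ∈ stoppingRules 𝓐 :=
  isStoppingTime_const 𝓐 n

theorem mem_stoppingRules_of_eqOn {n : ℕ} {D : Set Ω} (hD : MeasurableSet[𝓐 n] D)
    {τ σ ρ : Ω → ℕ∞} (hτ : τ ∈ stoppingRules 𝓐) (hσ : σ ∈ stoppingRules 𝓐)
    (hτD : ∀ ω ∈ D, n ≤ τ ω) (hσD : ∀ ω ∈ D, n ≤ σ ω) (hρD : ∀ ω ∈ D, ρ ω = τ ω)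
    (hρDc : ∀ ω ∉ D, ρ ω = σ ω) : ρ ∈ stoppingRules 𝓐 := by
  intro i
  change MeasurableSet[𝓐 i] {ω | ρ ω ≤ (i : ℕ∞)}
  rcases le_or_gt n i with hni | hni
  · have : {ω | ρ ω ≤ (i : ℕ∞)} = D ∩ {ω | τ ω ≤ i} ∪ Dᶜ ∩ {ω | σ ω ≤ i} := by
      ext ω
      by_cases h : ω ∈ D
      · simp [h, hρD ω h]
      · simp [h, hρDc ω h]
    rw [this]
    have hD' := 𝓐.mono hni _ hD
    exact (hD'.inter (hτ i)).union (hD'.compl.inter (hσ i))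
  · have : {ω | ρ ω ≤ (i : ℕ∞)} = {ω | σ ω ≤ i} := by
      ext ω
      by_cases h : ω ∈ D
      · have hi : (i : ℕ∞) < n := by exact_mod_cast hni
        simp only [Set.mem_ofPred_eq, hρD ω h]
        exact iff_of_false (hi.trans_le (hτD ω h)).not_ge (hi.trans_le (hσD ω h)).not_ge
      · simp [hρDc ω h]
    rw [this]
    exact hσ i

variable [MeasurableSpace S] {P : S → Measure Ω} {p : S → PMF S}

theorem IsMarkovChainFamily.entranceAfter_mem_stoppingRules [DiscreteMeasurableSpace S]
    (hZ : IsMarkovChainFamily 𝓐 P p Z) {σ : Ω → ℕ∞} (hσ : σ ∈ stoppingRules 𝓐) (B : Set S) :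
    entranceAfter Z σ B ∈ stoppingRules 𝓐 := by
  intro n
  have : {ω | entranceAfter Z σ B ω ≤ n} =
      ⋃ m : ℕ, ⋃ (_ : m ≤ n), {ω | σ ω ≤ m} ∩ {ω | Z m ω ∈ B} := by
    ext ω
    simp [entranceAfter_le_iff, and_left_comm]
  exact this ▸ MeasurableSet.iUnion fun m => MeasurableSet.iUnion fun hm =>
    (𝓐.mono hm _ (hσ m)).inter (hZ.measurableSet_mem hm B)

theorem IsMarkovChainFamily.entranceTime_mem_stoppingRules [DiscreteMeasurableSpace S]
    (hZ : IsMarkovChainFamily 𝓐 P p Z) (l : ℕ) (B : Set S) :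
    entranceTime Z l B ∈ stoppingRules 𝓐 :=
  entranceAfter_natCast (Z := Z) (B := B) l ▸
    hZ.entranceAfter_mem_stoppingRules (const_mem_stoppingRules 𝓐 l) B

theorem IsMarkovChainFamily.mem_stoppingRules_of_state [Countable S] [DiscreteMeasurableSpace S]
    (hZ : IsMarkovChainFamily 𝓐 P p Z) {n : ℕ} {τ : S → Ω → ℕ∞}
    (hτ : ∀ x, τ x ∈ stoppingRules 𝓐) (hn : ∀ x ω, n ≤ τ x ω) :
    (fun ω => τ (Z n ω) ω) ∈ stoppingRules 𝓐 := by
  intro i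
  change MeasurableSet[𝓐 i] {ω | τ (Z n ω) ω ≤ (i : ℕ∞)}
  rcases le_or_gt n i with hni | hni
  · have : {ω | τ (Z n ω) ω ≤ (i : ℕ∞)} = ⋃ x, {ω | Z n ω = x} ∩ {ω | τ x ω ≤ i} := by
      ext ω
      simp
    rw [this]
    exact MeasurableSet.iUnion fun x => (hZ.measurableSet_eq hni x).inter (hτ x i)
  · have : {ω | τ (Z n ω) ω ≤ (i : ℕ∞)} = ∅ := by
      ext ω
      have hi : (i : ℕ∞) < n := by exact_mod_cast hni
      simp [hi.trans_le (hn _ ω)]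
    rw [this]
    exact @MeasurableSet.empty _ (𝓐 i)

theorem IsMarkovChainFamily.expectation_payoffAt_zero [DiscreteMeasurableSpace S]
    (hZ : IsMarkovChainFamily 𝓐 P p Z) {α g : S → ℝ} (z : S) :
    expectation (P z) (payoffAt α g Z fun _ => 0) = g z := by
  have := hZ.isProbabilityMeasure z
  have h : payoffAt α g Z (fun _ => 0) =ᵐ[P z] fun _ => (g z : EReal) := by
    filter_upwards [hZ.start z] with ω hω
    simp [payoffAt, payoff, hω]
  have h₁ : ∫⁻ ω, (payoffAt α g Z (fun _ => 0) ω).toENNReal ∂(P z) = (g z : EReal).toENNReal := by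
    rw [lintegral_congr_ae (h.mono fun ω hω => congrArg EReal.toENNReal hω)]
    simp
  have h₂ : ∫⁻ ω, (-payoffAt α g Z (fun _ => 0) ω).toENNReal ∂(P z) =
      (-(g z : EReal)).toENNReal := by
    rw [lintegral_congr_ae (h.mono fun ω hω => congrArg (fun y => EReal.toENNReal (-y)) hω)]
    simp
  rw [expectation, h₁, h₂]
  rcases le_total 0 (g z) with hg | hg
  · rw [EReal.coe_toENNReal (by exact_mod_cast hg), EReal.toENNReal_of_nonpos (x := -_)]
    · simp
    · simpa using hg
  · rw [EReal.coe_toENNReal (x := -_), EReal.toENNReal_of_nonpos]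
    · simp
    · exact_mod_cast hg
    · simpa using hg

end StoppingRules

section Improvement

variable {Ω S : Type*} {mΩ : MeasurableSpace Ω} {P : S → Measure Ω} {Z : ℕ → Ω → S}
  {α g : S → ℝ}

theorem improveSet_subset (B : Set S) (k : ℕ) : improveSet P α g Z B k ⊆ B := fun _ h => h.1

variable [Countable S] [MeasurableSpace S] [DiscreteMeasurableSpace S] {𝓐 : Filtration ℕ mΩ}
  {p : S → PMF S}

/-- Stopping additionally on entering `improveSet P α g Z B k` after time `0` improves upon
`entranceTime Z l B` for `l ≤ k`. -/
theorem IsMarkovChainFamily.expectation_entranceTime_le_min (hZ : IsMarkovChainFamily 𝓐 P p Z)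
    (hα : ∀ z, 0 ≤ α z)
    (hexists : ∀ τ ∈ stoppingRules 𝓐, ∀ z : S, ExpectationExists (P z) (payoffAt α g Z τ))
    (B : Set S) {k l : ℕ} (hlk : l ≤ k) (z : S) :
    expectation (P z) (payoffAt α g Z (entranceTime Z l B)) ≤
      expectation (P z) (payoffAt α g Z fun ω =>
        min (entranceTime Z l B ω) (entranceTime Z 1 (improveSet P α g Z B k) ω)) := by
  classical
  set B' := improveSet P α g Z B k with hB'
  let w : ℕ → Ω → ℕ∞ := fun j ω =>
    if entranceTime Z 1 B' ω < j then entranceTime Z 1 B' ω else entranceTime Z l B ω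
  have hsucc : ∀ (j : ℕ) ω, entranceTime Z 1 B' ω ≠ j → w (j + 1) ω = w j ω := by
    intro j ω h
    have : entranceTime Z 1 B' ω < ((j + 1 : ℕ) : ℕ∞) ↔ entranceTime Z 1 B' ω < j := by
      rw [Nat.cast_add, Nat.cast_one, ENat.lt_natCast_add_one_iff]
      exact ⟨fun h' => lt_of_le_of_ne h' h, le_of_lt⟩
    simp only [w, this]
  have main : ∀ j ≤ l, w j ∈ stoppingRules 𝓐 ∧
      expectation (P z) (payoffAt α g Z (entranceTime Z l B)) ≤
        expectation (P z) (payoffAt α g Z (w j)) := by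
    intro j
    induction j with
    | zero =>
      intro _
      have : w 0 = entranceTime Z l B := by ext ω; simp [w]
      rw [this]
      exact ⟨hZ.entranceTime_mem_stoppingRules l B, le_rfl⟩
    | succ j ih =>
      intro hj
      obtain ⟨hw, hle⟩ := ih (by omega)
      have hD : MeasurableSet[𝓐 j] {ω | entranceTime Z 1 B' ω = j} :=
        IsStoppingTime.measurableSet_eq (hZ.entranceTime_mem_stoppingRules 1 B') j
      have hwD : ∀ ω ∈ {ω | entranceTime Z 1 B' ω = j}, w j ω = entranceTime Z l B ω := by
        intro ω hω
        simp only [Set.mem_ofPred_eq] at hω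
        simp [w, hω]
      have hwD' : ∀ ω ∈ {ω | entranceTime Z 1 B' ω = j}, w (j + 1) ω = j := by
        intro ω hω
        simp only [Set.mem_ofPred_eq] at hω
        have : (j : ℕ∞) < ((j + 1 : ℕ) : ℕ∞) := by exact_mod_cast j.lt_succ_self
        simp only [w, hω, if_pos this]
      have hw' : w (j + 1) ∈ stoppingRules 𝓐 := by
        refine mem_stoppingRules_of_eqOn hD (const_mem_stoppingRules 𝓐 j) hw
          (fun _ _ => le_rfl) (fun ω hω => ?_) hwD' fun ω hω => hsucc j ω hω
        rw [hwD ω hω]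
        refine le_trans ?_ (natCast_le_entranceTime l)
        exact_mod_cast (by omega : j ≤ l)
      refine ⟨hw', hle.trans ?_⟩
      refine hZ.expectation_le_of_continuation hα hexists hD hw hw'
        (u := fun _ => entranceTime (fun i (s : ℕ → S) => s i) (l - j) B) (u' := fun _ _ => 0)
        (fun _ => measurable_entranceTime_path _ _) (fun _ => measurable_const)
        (fun _ => hZ.entranceTime_mem_stoppingRules (l - j) B)
        (fun _ => const_mem_stoppingRules 𝓐 0) ?_ ?_ (fun ω hω => (hsucc j ω hω).symm) ?_ z
      · intro ω hω
        rw [hwD ω hω, ← entranceTime_add, show j + (l - j) = l by omega]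
      · intro ω hω
        rw [hwD' ω hω, add_zero]
      · intro ω hω
        rw [hZ.expectation_payoffAt_zero]
        exact (entranceTime_mem hω).2 (l - j) (by omega) (by omega)
  refine (main l le_rfl).2.trans (le_of_eq ?_)
  congr 1
  ext ω
  refine payoffAt_congr ?_
  simp only [w]
  split_ifs with h
  · exact (min_eq_right (h.le.trans (natCast_le_entranceTime l))).symm
  · rw [min_eq_left]
    push Not at h
    induction hn : entranceTime Z 1 B' ω with
    | top => exact le_top
    | coe n =>
      rw [hn] at h
      exact entranceTime_le_iff.2 ⟨n, le_rfl, by exact_mod_cast h,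
        improveSet_subset B k (entranceTime_mem hn)⟩

/-- A stopping rule that stops only in `B` is improved by waiting for the first entrance into
`improveSet P α g Z B k`. -/
theorem IsMarkovChainFamily.expectation_le_entranceAfter_improveSet
    (hZ : IsMarkovChainFamily 𝓐 P p Z) (hα : ∀ z, 0 ≤ α z)
    (hexists : ∀ τ ∈ stoppingRules 𝓐, ∀ z : S, ExpectationExists (P z) (payoffAt α g Z τ))
    (hlim : ∀ σ : ℕ → Ω → ℕ∞, (∀ n, σ n ∈ stoppingRules 𝓐) → Monotone σ → ∀ z : S,
      Tendsto (fun n => expectation (P z) (payoffAt α g Z (σ n))) atTop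
        (𝓝 (expectation (P z) (payoffAt α g Z (fun ω => ⨆ n, σ n ω)))))
    {B : Set S} (k : ℕ) {σ : Ω → ℕ∞} (hσ : σ ∈ stoppingRulesIn 𝓐 Z B) (z : S) :
    expectation (P z) (payoffAt α g Z σ) ≤
      expectation (P z) (payoffAt α g Z (entranceAfter Z σ (improveSet P α g Z B k))) := by
  classical
  have hmin := fun {l : ℕ} => hZ.expectation_entranceTime_le_min hα hexists B (k := k) (l := l)
  set B' := improveSet P α g Z B k with hB'
  obtain ⟨hσs, hσB⟩ := mem_stoppingRulesIn_iff.1 hσ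
  have hL : ∀ x, ∃ l : ℕ, 1 ≤ l ∧ (x ∈ B → x ∉ B' → l ≤ k ∧
      (g x : EReal) ≤ expectation (P x) (payoffAt α g Z (entranceTime Z l B))) := by
    intro x
    by_cases hx : x ∈ B ∧ x ∉ B'
    · have : ∃ l : ℕ, 1 ≤ l ∧ l ≤ k ∧
          (g x : EReal) < expectation (P x) (payoffAt α g Z (entranceTime Z l B)) := by
        by_contra! hcon
        exact hx.2 ⟨hx.1, hcon⟩
      obtain ⟨l, h₁, h₂, h₃⟩ := this
      exact ⟨l, h₁, fun _ _ => ⟨h₂, h₃.le⟩⟩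
    · exact ⟨1, le_rfl, fun h₁ h₂ => absurd ⟨h₁, h₂⟩ hx⟩
  choose L hL₁ hL using hL
  let u : S → (ℕ → S) → ℕ∞ := fun x s => min (entranceTime (fun i (s : ℕ → S) => s i) (L x) B s)
    (entranceTime (fun i (s : ℕ → S) => s i) 1 B' s)
  let v : ℕ → Ω → ℕ∞ := fun j ω =>
    min (entranceTime Z (j + L (Z j ω)) B ω) (entranceTime Z (j + 1) B' ω)
  let s : ℕ → Ω → ℕ∞ := fun j => Nat.rec (motive := fun _ => Ω → ℕ∞) σ
    (fun j τ ω => if τ ω = (j : ℕ∞) ∧ Z j ω ∉ B' then v j ω else τ ω) j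
  have s_succ : ∀ j ω, s (j + 1) ω = if s j ω = j ∧ Z j ω ∉ B' then v j ω else s j ω :=
    fun j ω => rfl
  have hvlt : ∀ (j : ℕ) ω, ((j + 1 : ℕ) : ℕ∞) ≤ v j ω := fun j ω => by
    refine le_min (le_trans ?_ (natCast_le_entranceTime _)) (natCast_le_entranceTime _)
    have := hL₁ (Z j ω)
    exact_mod_cast (by omega : j + 1 ≤ j + L (Z j ω))
  have hjv : ∀ (j : ℕ) ω, (j : ℕ∞) ≤ v j ω := fun j ω =>
    le_trans (by exact_mod_cast j.le_succ) (hvlt j ω)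
  have hvs : ∀ j, v j ∈ stoppingRules 𝓐 := fun j => by
    refine IsStoppingTime.min ?_ (hZ.entranceTime_mem_stoppingRules (j + 1) B')
    refine hZ.mem_stoppingRules_of_state (τ := fun x => entranceTime Z (j + L x) B)
      (fun x => hZ.entranceTime_mem_stoppingRules _ B) fun x ω => ?_
    exact le_trans (by exact_mod_cast Nat.le_add_right j _) (natCast_le_entranceTime _)
  have hDm : ∀ j, s j ∈ stoppingRules 𝓐 →
      MeasurableSet[𝓐 j] {ω | s j ω = j ∧ Z j ω ∉ B'} := fun j hj =>
    (IsStoppingTime.measurableSet_eq hj j).inter (hZ.measurableSet_mem le_rfl B'ᶜ)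
  have hss : ∀ j, s j ∈ stoppingRules 𝓐 := by
    intro j
    induction j with
    | zero => exact hσs
    | succ j ih =>
      exact mem_stoppingRules_of_eqOn (hDm j ih) (hvs j) ih (fun ω _ => hjv j ω)
        (fun ω hω => hω.1.ge) (fun ω hω => (s_succ j ω).trans (if_pos hω))
        fun ω hω => (s_succ j ω).trans (if_neg hω)
  have hsB : ∀ j ω, ∀ n : ℕ, s j ω = n → Z n ω ∈ B := by
    intro j
    induction j with
    | zero => exact hσB
    | succ j ih =>
      intro ω n hn
      rw [s_succ] at hn
      split_ifs at hn with h
      · rcases min_choice (entranceTime Z (j + L (Z j ω)) B ω) (entranceTime Z (j + 1) B' ω)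
          with h' | h'
        · exact entranceTime_mem (h'.symm.trans hn)
        · exact improveSet_subset B k (entranceTime_mem (h'.symm.trans hn))
      · exact ih ω n hn
  have hsB' : ∀ j ω, ∀ n : ℕ, s j ω = n → n < j → Z n ω ∈ B' := by
    intro j
    induction j with
    | zero => intro ω n _ hn; omega
    | succ j ih =>
      intro ω n hn hnj
      rw [s_succ] at hn
      split_ifs at hn with h
      · have h₁ := hn ▸ hvlt j ω
        have h₂ : j + 1 ≤ n := by exact_mod_cast h₁
        omega
      · rcases (Nat.lt_succ_iff.1 hnj).lt_or_eq with hlt | rfl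
        · exact ih ω n hn hlt
        · by_contra hB
          exact h ⟨hn, hB⟩
  have hmono_succ : ∀ j ω, s j ω ≤ s (j + 1) ω := by
    intro j ω
    rw [s_succ]
    split_ifs with h
    · exact h.1.le.trans (hjv j ω)
    · exact le_rfl
  have hmono : Monotone s := monotone_nat_of_le_succ hmono_succ
  have hle : ∀ j ω, s j ω ≤ entranceAfter Z σ B' ω := by
    intro j
    induction j with
    | zero => exact fun ω => le_entranceAfter ω
    | succ j ih =>
      intro ω
      rw [s_succ]
      split_ifs with h
      · induction hn : entranceAfter Z σ B' ω with
        | top => exact le_top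
        | coe n =>
          have hjn : j ≤ n := by exact_mod_cast h.1 ▸ hn ▸ ih ω
          have hnB := entranceAfter_mem hn
          have hne : j ≠ n := fun e => h.2 (e ▸ hnB)
          exact (min_le_right _ _).trans (entranceTime_le_iff.2 ⟨n, le_rfl, by omega, hnB⟩)
      · exact ih ω
  have hsup : (fun ω => ⨆ j, s j ω) = entranceAfter Z σ B' := by
    ext ω : 1
    refine le_antisymm (iSup_le fun j => hle j ω) ?_
    induction hn : ⨆ j, s j ω with
    | top => exact le_top
    | coe n =>
      have h : s (n + 1) ω ≤ n := hn ▸ le_iSup (fun j => s j ω) (n + 1)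
      have hne := ne_top_of_le_ne_top (ENat.natCast_ne_top n) h
      obtain ⟨m, hm⟩ := ENat.ne_top_iff_exists.1 hne
      have hmn : m ≤ n := by exact_mod_cast hm ▸ h
      exact entranceAfter_le_iff.2 ⟨m, hmn, hm ▸ hmono (Nat.zero_le (n + 1)) ω,
        hsB' (n + 1) ω m hm.symm (by omega)⟩
  have hE : ∀ j, expectation (P z) (payoffAt α g Z (s j)) ≤
      expectation (P z) (payoffAt α g Z (s (j + 1))) := by
    intro j
    refine hZ.expectation_le_of_continuation hα hexists (hDm j (hss j)) (hss j) (hss (j + 1))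
      (u := fun _ _ => 0) (u' := u) (fun _ => measurable_const)
      (fun x => (Measurable.of_discrete (f := fun q : ℕ∞ × ℕ∞ => min q.1 q.2)).comp
        ((measurable_entranceTime_path _ _).prodMk (measurable_entranceTime_path _ _)))
      (fun _ => const_mem_stoppingRules 𝓐 0)
      (fun x => IsStoppingTime.min (hZ.entranceTime_mem_stoppingRules (L x) B)
        (hZ.entranceTime_mem_stoppingRules 1 B')) ?_ ?_
      (fun ω hω => ((s_succ j ω).trans (if_neg hω)).symm) ?_ z
    · intro ω hω
      rw [hω.1, add_zero]
    · intro ω hω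
      refine (s_succ j ω).trans ((if_pos hω).trans ?_)
      simp only [v, u, entranceTime_add]
      exact (min_add_add_left _ _ _)
    · intro ω hω
      rw [hZ.expectation_payoffAt_zero]
      obtain ⟨h₁, h₂⟩ := hL (Z j ω) (hsB j ω j hω.1) hω.2
      exact h₂.trans (hmin h₁ _)
  have hlim' := hlim s hss hmono z
  rw [hsup] at hlim'
  exact (monotone_nat_of_le_succ hE).ge_of_tendsto hlim' 0

/-- If `g z` dominates the value of waiting for the next entrance into `F` for all `z ∈ F`, then
it is optimal to stop on the first entrance into `F`. -/
theorem IsMarkovChainFamily.expectation_le_entranceTime (hZ : IsMarkovChainFamily 𝓐 P p Z)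
    (hα : ∀ z, 0 ≤ α z)
    (hexists : ∀ τ ∈ stoppingRules 𝓐, ∀ z : S, ExpectationExists (P z) (payoffAt α g Z τ))
    (hlim : ∀ σ : ℕ → Ω → ℕ∞, (∀ n, σ n ∈ stoppingRules 𝓐) → Monotone σ → ∀ z : S,
      Tendsto (fun n => expectation (P z) (payoffAt α g Z (σ n))) atTop
        (𝓝 (expectation (P z) (payoffAt α g Z (fun ω => ⨆ n, σ n ω)))))
    {F : Set S}
    (hF : ∀ x ∈ F, expectation (P x) (payoffAt α g Z (entranceTime Z 1 F)) ≤ (g x : EReal))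
    {σ : Ω → ℕ∞} (hσ : σ ∈ stoppingRulesIn 𝓐 Z F) (z : S) :
    expectation (P z) (payoffAt α g Z σ) ≤
      expectation (P z) (payoffAt α g Z (entranceTime Z 0 F)) := by
  obtain ⟨hσs, hσF⟩ := mem_stoppingRulesIn_iff.1 hσ
  let r : ℕ → Ω → ℕ∞ := fun j ω => min (σ ω) (entranceTime Z j F ω)
  have hle : ∀ (j : ℕ) ω, (j : ℕ∞) ≤ σ ω → entranceTime Z j F ω ≤ σ ω := by
    intro j ω h
    induction hn : σ ω with
    | top => exact le_top
    | coe n =>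
      exact entranceTime_le_iff.2 ⟨n, le_rfl, by exact_mod_cast hn ▸ h, hσF ω n hn⟩
  have hr : ∀ j, r j ∈ stoppingRules 𝓐 := fun j =>
    IsStoppingTime.min hσs (hZ.entranceTime_mem_stoppingRules j F)
  have hD : ∀ j, MeasurableSet[𝓐 j] {ω | (j : ℕ∞) < σ ω ∧ Z j ω ∈ F} := fun j =>
    (IsStoppingTime.measurableSet_gt hσs j).inter (hZ.measurableSet_mem le_rfl F)
  have hmono : Monotone r := monotone_nat_of_le_succ fun j ω =>
    min_le_min le_rfl (hittingAfter_apply_mono Z F ω j.le_succ)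
  have hsup : (fun ω => ⨆ j, r j ω) = σ := by
    ext ω : 1
    refine le_antisymm (iSup_le fun j => min_le_left _ _) ?_
    refine ENat.forall_natCast_le_iff_le.1 fun n hn => ?_
    exact (le_min hn (natCast_le_entranceTime n)).trans (le_iSup (fun j => r j ω) n)
  have h₀ : r 0 = entranceTime Z 0 F := by
    ext ω : 1
    exact min_eq_right (hle 0 ω (by simp))
  have hE : ∀ j, expectation (P z) (payoffAt α g Z (r (j + 1))) ≤
      expectation (P z) (payoffAt α g Z (r j)) := by
    intro j
    refine hZ.expectation_le_of_continuation hα hexists (hD j) (hr (j + 1)) (hr j)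
      (u := fun _ => entranceTime (fun i (s : ℕ → S) => s i) 1 F) (u' := fun _ _ => 0)
      (fun _ => measurable_entranceTime_path _ _) (fun _ => measurable_const)
      (fun _ => hZ.entranceTime_mem_stoppingRules 1 F)
      (fun _ => const_mem_stoppingRules 𝓐 0) ?_ ?_ ?_ ?_ z
    · intro ω hω
      rw [← entranceTime_add]
      refine min_eq_right (hle (j + 1) ω ?_)
      rw [Nat.cast_add, Nat.cast_one]
      exact Order.add_one_le_of_lt hω.1
    · intro ω hω
      have : entranceTime Z j F ω = j := le_antisymm
        (entranceTime_le_iff.2 ⟨j, le_rfl, le_rfl, hω.2⟩) (natCast_le_entranceTime j)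
      simp only [r, this, add_zero, min_eq_right hω.1.le]
    · intro ω hω
      by_cases hj : Z j ω ∈ F
      · have hσj : σ ω ≤ j := not_lt.1 fun h => hω ⟨h, hj⟩
        have h₁ := hσj.trans (natCast_le_entranceTime (Z := Z) (B := F) (ω := ω) j)
        have h₂ := h₁.trans (hittingAfter_apply_mono Z F ω j.le_succ)
        exact (min_eq_left h₂).trans (min_eq_left h₁).symm
      · simp only [r, entranceTime_succ hj]
    · intro ω hω
      rw [hZ.expectation_payoffAt_zero]
      exact hF _ hω.2
  have hlim' := hlim r hr hmono z
  rw [hsup] at hlim'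
  exact h₀ ▸ (antitone_nat_of_succ_le hE).le_of_tendsto hlim' 0

end Improvement

theorem theorem1 {Ω S : Type*} {mΩ : MeasurableSpace Ω}
    [Countable S] [MeasurableSpace S] [DiscreteMeasurableSpace S]
    (𝓐 : Filtration ℕ mΩ) (P : S → Measure Ω) (p : S → PMF S) (Z : ℕ → Ω → S)
    (hZ : IsMarkovChainFamily 𝓐 P p Z)
    (g α : S → ℝ) (hα : ∀ z, α z ∈ Set.Icc (0 : ℝ) 1)
    (hexists : ∀ τ ∈ stoppingRules 𝓐, ∀ z : S, ExpectationExists (P z) (payoffAt α g Z τ))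
    (hlim : ∀ σ : ℕ → Ω → ℕ∞, (∀ n, σ n ∈ stoppingRules 𝓐) → Monotone σ → ∀ z : S,
      Tendsto (fun n => expectation (P z) (payoffAt α g Z (σ n))) atTop
        (𝓝 (expectation (P z) (payoffAt α g Z (fun ω => ⨆ n, σ n ω)))))
    (κ : ℕ → ℕ) (hκ : ∀ k, 1 ≤ k → 1 ≤ κ k)
    (B₀ : Set S) (B : ℕ → Set S) (hB : B = iterSet P α g Z κ B₀)
    (F : Set S) (hF : F = ⋂ k, B k) :
    IsOptimalIn P α g Z (stoppingRulesIn 𝓐 Z B₀) (entranceTime Z 0 F) ∧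
    (∀ (k : ℕ) (ω : Ω), entranceTime Z 0 (B k) ω ≤ entranceTime Z 0 (B (k + 1)) ω) ∧
    (∀ ω : Ω, Tendsto (fun k => entranceTime Z 0 (B k) ω) atTop
      (𝓝 (entranceTime Z 0 F ω))) ∧
    (∀ (k : ℕ) (z : S),
      expectation (P z) (payoffAt α g Z (entranceTime Z 0 (B k))) ≤
        expectation (P z) (payoffAt α g Z (entranceTime Z 0 (B (k + 1))))) := by
  have hα₀ : ∀ z, 0 ≤ α z := fun z => (hα z).1
  have hB0 : B 0 = B₀ := by rw [hB]; rfl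
  have hBs : ∀ k, B (k + 1) = improveSet P α g Z (B k) (κ (k + 1)) := fun k => by rw [hB]; rfl
  have hanti : Antitone B := antitone_nat_of_succ_le fun k => by
    rw [hBs]
    exact improveSet_subset _ _
  have hsup : ∀ l ω, ⨆ k, entranceTime Z l (B k) ω = entranceTime Z l F ω := by
    intro l ω
    simp only [← entranceAfter_natCast, hF]
    exact iSup_entranceAfter hanti _ ω
  have hmono : ∀ l, Monotone fun k => entranceTime Z l (B k) :=
    fun l i j hij => hittingAfter_anti Z l (hanti hij)
  have hFg : ∀ x ∈ F, expectation (P x) (payoffAt α g Z (entranceTime Z 1 F)) ≤ (g x : EReal) := by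
    intro x hx
    have h := hlim (fun k => entranceTime Z 1 (B k))
      (fun k => hZ.entranceTime_mem_stoppingRules 1 _) (hmono 1) x
    simp only [hsup] at h
    refine le_of_tendsto' h fun k => ?_
    have hxk : x ∈ B (k + 1) := Set.mem_iInter.1 (hF ▸ hx) (k + 1)
    rw [hBs] at hxk
    exact hxk.2 1 le_rfl (hκ (k + 1) (by omega))
  have hstep : ∀ (k : ℕ) (σ : Ω → ℕ∞), σ ∈ stoppingRules 𝓐 → ∀ z,
      expectation (P z) (payoffAt α g Z (entranceAfter Z σ (B k))) ≤
        expectation (P z) (payoffAt α g Z (entranceAfter Z σ (B (k + 1)))) := by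
    intro k σ hσ z
    have h := hZ.expectation_le_entranceAfter_improveSet hα₀ hexists hlim (κ (k + 1))
      (mem_stoppingRulesIn_iff.2 ⟨hZ.entranceAfter_mem_stoppingRules hσ (B k),
        fun ω n hn => entranceAfter_mem hn⟩) z
    rwa [← hBs, entranceAfter_entranceAfter (hanti k.le_succ)] at h
  refine ⟨⟨mem_stoppingRulesIn_iff.2 ⟨hZ.entranceTime_mem_stoppingRules 0 F,
    fun ω n hn => ?_⟩, fun σ hσ z => ?_⟩, fun k => hmono 0 k.le_succ, fun ω => ?_, fun k z => ?_⟩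
  · exact hB0 ▸ Set.mem_iInter.1 (hF ▸ entranceTime_mem hn) 0
  · obtain ⟨hσs, hσB⟩ := mem_stoppingRulesIn_iff.1 hσ
    have h₀ : entranceAfter Z σ (B 0) = σ :=
      funext fun ω => entranceAfter_eq_self fun n hn => hB0 ▸ hσB ω n hn
    have h := hlim (fun k => entranceAfter Z σ (B k))
      (fun k => hZ.entranceAfter_mem_stoppingRules hσs _)
      (fun i j hij ω => entranceAfter_anti (hanti hij) ω) z
    simp only [iSup_entranceAfter hanti, ← hF] at h
    have h₁ := (monotone_nat_of_le_succ fun k => hstep k σ hσs z).ge_of_tendsto h 0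
    rw [h₀] at h₁
    exact h₁.trans (hZ.expectation_le_entranceTime hα₀ hexists hlim hFg
      (mem_stoppingRulesIn_iff.2 ⟨hZ.entranceAfter_mem_stoppingRules hσs F,
        fun ω n hn => entranceAfter_mem hn⟩) z)
  · rw [← hsup 0 ω]
    exact tendsto_atTop_iSup fun i j hij => hmono 0 hij ω
  · have h := hstep k _ (const_mem_stoppingRules 𝓐 0) z
    rwa [entranceAfter_natCast, entranceAfter_natCast] at h
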